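/- Fix a finite input alphabet $A$ and a finite output alphabet $B$. A string-to-string transducer with origin information is a function $f$ that maps every input string $w\in A^*$ to an output string $f(w)\in B^*$ together with an origin mapping, which is a function from the positions of $f(w)$ to the positions of $w$. A streaming transducer has finitely many control states, one of them initial, and finitely many registers, one of them the output register. Its transition function maps a control state and an input letter to a control state and a finite sequence of register operations, each of the form "replace the contents of register $r$ by $rs$ and erase register $s$" (with $r\neq s$) or "replace the contents of register $r$ by the output letter $b$". Its end of input function maps each control state to a finite sequence of operations of the first form, which are executed after the whole input has been read. Initially all registers are empty, the input is read from left to right, and the output is the final content of the output register; the origin of an output letter is the input position at which the letter was created. The transducer $f$ is called regular if it is recognised, including origins, by a streaming transducer. For strings $v,w\in A^*$, let $f(\underline v|\underline w)$ be the string over $\{\mathrm{left},\mathrm{right}\}$ obtained from $f(vw)$ by replacing every output letter by $\mathrm{left}$ if its origin is in $v$ and by $\mathrm{right}$ if its origin is in $w$, and then replacing every maximal block of equal consecutive symbols by a single symbol. Theorem. Let $f$ be a regular string-to-string transducer with origin information. Then the following conditions are equivalent. 1. For every input string $w$, the origin mapping from the positions of the output $f(w)$ to the positions of the input $w$ is order-preserving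 (in the weak sense: $x\le y$ implies that the origin of $x$ is at most the origin of $y$). 2. $f(\underline v|\underline w)$ belongs to $(\varepsilon+\mathrm{left})(\varepsilon+\mathrm{right})$ for all input strings $v,w$. 3. $f$ is recognised, including origins, by a streaming transducer with lookahead which has only one register and whose only register operations append an output letter to the end of that register. Here lookahead means that the transition at an input position may also depend on the state reached by a finite deterministic right-to-left automaton after reading the suffix that follows this position. 4. $f$ is recognised, including origins, by a nondeterministic one-way automaton with output which has exactly one (accepting) run over every input string. Such an automaton has finitely many states, sets of initial and of accepting states, and finitely many transitions, each of which reads one input letter and is labelled by a string in $B^*$; the output is the concatenation of the labels of the transitions in the run, and the origin of an output letter is the input position read by the transition that produced it. -/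

import Mathlib

universe u v

/-! ### String-to-string functions with origin information -/

/-- A string-to-string transducer with origin information, as a semantic object: every input
string `w` is mapped to an output string, each of whose letters carries its origin, a position
of `w`. Positions are numbered from `0`. -/
def OriginTransducer (A : Type u) (B : Type v) : Type (max u v) :=
  (w : List A) → List (B × Fin w.length)

namespace OriginTransducer

variable {A : Type u} {B : Type v}

/-- The origin mapping, from positions of the output `f w` to positions of the input `w`. -/
def origin (f : OriginTransducer A B) (w : List A) : Fin (f w).length → Fin w.length :=
  fun x => ((f w).get x).2

/-- For every input string the origin mapping is order-preserving. -/
def OrderPreserving (f : OriginTransducer A B) : Prop :=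
  ∀ w : List A, Monotone (f.origin w)

/-- The output string `f w`, with the origins given as natural numbers. -/
def value (f : OriginTransducer A B) (w : List A) : List (B × ℕ) :=
  (f w).map fun p => (p.1, (p.2 : ℕ))

end OriginTransducer

/-! ### Factored outputs -/

/-- An `X`-factored output over the output alphabet `B`: a sequence of blocks, each consisting of
a source identifier from `X` and an output assignment, which may be undefined (`none`). -/
abbrev FactoredOutput (X : Type*) (B : Type*) := List (X × Option (List B))

namespace FactoredOutput

variable {X : Type*} {B : Type*}

/-- Put a letter `b` of colour `c` in front of a factored output: it joins the first block if that
block has the colour `c`, and otherwise it becomes a new block. -/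
def cons [DecidableEq X] (c : X) (b : B) : FactoredOutput X B → FactoredOutput X B
  | [] => [(c, some [b])]
  | (c', s) :: bs =>
      if c = c' then (c, s.map (List.cons b)) :: bs else (c, some [b]) :: (c', s) :: bs

open Classical in
/-- Make the output assignment undefined in all blocks whose source identifier is in `U`. -/
noncomputable def underline (U : Set X) (bs : FactoredOutput X B) : FactoredOutput X B :=
  bs.map fun p => if p.1 ∈ U then (p.1, none) else p

end FactoredOutput

/-- The source identifiers for a factorisation of the input into a left and a right part. -/
inductive Side
  | left
  | right
  deriving DecidableEq

namespace OriginTransducer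

variable {A : Type u} {B : Type v}

/-- The factored output `f(w)/σ`: the maximal blocks of consecutive output letters whose origins
have the same colour under `σ`, each labelled by that colour. -/
def factored {X : Type*} [DecidableEq X] (f : OriginTransducer A B) (w : List A)
    (σ : Fin w.length → X) : FactoredOutput X B :=
  (f w).foldr (fun p bs => FactoredOutput.cons (σ p.2) p.1 bs) []

/-- `f(v|w)`. -/
def split (f : OriginTransducer A B) (v w : List A) : FactoredOutput Side B :=
  f.factored (v ++ w) fun i => if (i : ℕ) < v.length then Side.left else Side.right

/-- `f(v̲|w̲)`: both parts of the input are underlined. -/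
noncomputable def splitUnderlined (f : OriginTransducer A B) (v w : List A) :
    FactoredOutput Side B :=
  (f.split v w).underline {Side.left, Side.right}

/-- The block with source identifier `s` and undefined output assignment. -/
def bareBlock (B : Type v) (s : Side) : Side × Option (List B) := (s, none)

/-- `f(v̲|w̲)` belongs to `(ε + left)(ε + right)` for all input strings `v`, `w`. -/
def LeftThenRight (f : OriginTransducer A B) : Prop :=
  ∀ v w : List A, f.splitUnderlined v w ∈
    ((1 + {[bareBlock B Side.left]}) * (1 + {[bareBlock B Side.right]}) :
      Language (Side × Option (List B)))

end OriginTransducer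

/-! ### Streaming transducers -/

/-- The operation "replace the contents of the register `r = dst` by `rs`, where `s = src`, and
erase `s`". The two registers are distinct, so that nothing is copied. -/
structure RegConcat (R : Type) where
  dst : R
  src : R
  ne : dst ≠ src

/-- Register operations. The first two are the atomic ones; the third one appends an output
letter to the end of a register. -/
inductive RegOp (R : Type) (B : Type v)
  | concat (c : RegConcat R) : RegOp R B
  | load (r : R) (b : B) : RegOp R B
  | append (r : R) (b : B) : RegOp R B

open Classical in
/-- The effect of a concatenation on a register valuation. A register stores a sequence of output
letters together with their origins. -/
noncomputable def RegConcat.apply {R : Type} {B : Type v} (c : RegConcat R)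
    (ν : R → List (B × ℕ)) : R → List (B × ℕ) :=
  Function.update (Function.update ν c.dst (ν c.dst ++ ν c.src)) c.src []

open Classical in
/-- The effect of a register operation that is executed at the input position `i`. A newly created
letter gets the origin `i`. -/
noncomputable def RegOp.apply {R : Type} {B : Type v} (i : ℕ) (ν : R → List (B × ℕ)) :
    RegOp R B → (R → List (B × ℕ))
  | .concat c => c.apply ν
  | .load r b => Function.update ν r [(b, i)]
  | .append r b => Function.update ν r (ν r ++ [(b, i)])

/-- The operation is one of the two atomic ones. -/
def RegOp.IsAtomic {R : Type} {B : Type v} : RegOp R B → Prop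
  | .concat _ => True
  | .load _ _ => True
  | .append _ _ => False

/-- The operation appends a letter to a register. -/
def RegOp.IsAppend {R : Type} {B : Type v} : RegOp R B → Prop
  | .concat _ => False
  | .load _ _ => False
  | .append _ _ => True

/-- A streaming transducer. The end of input function `final` may only concatenate registers. -/
structure StreamingTransducer (A : Type u) (B : Type v) where
  State : Type
  finite_state : Finite State
  Reg : Type
  finite_reg : Finite Reg
  start : State
  outReg : Reg
  step : State → A → State × List (RegOp Reg B)
  final : State → List (RegConcat Reg)

namespace StreamingTransducer

variable {A : Type u} {B : Type v}

/-- A configuration: the control state and the register valuation. -/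
abbrev Config (T : StreamingTransducer A B) := T.State × (T.Reg → List (B × ℕ))

/-- Process the letter `p.1` at the input position `p.2`. -/
noncomputable def next (T : StreamingTransducer A B) (c : T.Config) (p : A × ℕ) : T.Config :=
  ((T.step c.1 p.1).1, (T.step c.1 p.1).2.foldl (RegOp.apply p.2) c.2)

/-- The configuration after the whole input has been read, all registers being empty initially. -/
noncomputable def run (T : StreamingTransducer A B) (w : List A) : T.Config :=
  w.zipIdx.foldl T.next (T.start, fun _ => [])

/-- The output, with origins: apply the end of input function and read the output register. -/
noncomputable def output (T : StreamingTransducer A B) (w : List A) : List (B × ℕ) :=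
  ((T.final (T.run w).1).foldl (fun ν c => c.apply ν) (T.run w).2) T.outReg

/-- Only the two atomic register operations are used. -/
def IsAtomic (T : StreamingTransducer A B) : Prop :=
  ∀ q a, ∀ o ∈ (T.step q a).2, o.IsAtomic

/-- There is only one register, and letters are appended to it, nothing else. -/
def IsOneRegisterAppendOnly (T : StreamingTransducer A B) : Prop :=
  Nat.card T.Reg = 1 ∧ (∀ q a, ∀ o ∈ (T.step q a).2, o.IsAppend) ∧ ∀ q, T.final q = []

end StreamingTransducer

/-- A transducer with origin information is regular if it is recognised by a streaming
transducer. -/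
def OriginTransducer.IsRegular {A : Type u} {B : Type v} (f : OriginTransducer A B) : Prop :=
  ∃ T : StreamingTransducer A B, T.IsAtomic ∧ ∀ w, T.output w = f.value w

/-- A streaming transducer with lookahead: at every input position, the transition may also depend
on the state in which a deterministic right-to-left automaton is after reading the suffix that
follows this position. -/
structure LookaheadTransducer (A : Type u) (B : Type v) where
  Look : Type
  finite_look : Finite Look
  lookStart : Look
  lookStep : Look → A → Look
  core : StreamingTransducer (A × Look) B

namespace LookaheadTransducer

variable {A : Type u} {B : Type v}

/-- The state of the lookahead automaton after reading `w` from right to left. -/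
def lookState (T : LookaheadTransducer A B) (w : List A) : T.Look :=
  w.foldr (fun a l => T.lookStep l a) T.lookStart

/-- Label each position of the input additionally by its lookahead. -/
def annotate (T : LookaheadTransducer A B) : List A → List (A × T.Look)
  | [] => []
  | a :: w => (a, T.lookState w) :: annotate T w

/-- The output, with origins. -/
noncomputable def output (T : LookaheadTransducer A B) (w : List A) : List (B × ℕ) :=
  T.core.output (T.annotate w)

end LookaheadTransducer

/-- `f` is recognised by a streaming transducer with lookahead which has only one register, and
which only appends output letters to that register. -/
def OriginTransducer.IsOneRegisterLookahead {A : Type u} {B : Type v}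
    (f : OriginTransducer A B) : Prop :=
  ∃ T : LookaheadTransducer A B, T.core.IsOneRegisterAppendOnly ∧ ∀ w, T.output w = f.value w

/-! ### Nondeterministic one-way automata with output -/

/-- A transition with source and target state, input letter, and output string. -/
structure OutTransition (Q : Type) (A : Type u) (B : Type v) where
  src : Q
  letter : A
  out : List B
  tgt : Q

/-- A nondeterministic one-way automaton with output. -/
structure OneWayAutomaton (A : Type u) (B : Type v) where
  State : Type
  finite_state : Finite State
  initial : Set State
  accepting : Set State
  trans : Set (OutTransition State A B)
  finite_trans : trans.Finite

namespace OneWayAutomaton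

variable {A : Type u} {B : Type v}

/-- The sequence of transitions is a path over the input `w` from `q` to an accepting state. -/
def IsAcceptingPath (M : OneWayAutomaton A B) :
    M.State → List A → List (OutTransition M.State A B) → Prop
  | q, [], [] => q ∈ M.accepting
  | q, a :: w, t :: ts =>
      t ∈ M.trans ∧ t.src = q ∧ t.letter = a ∧ IsAcceptingPath M t.tgt w ts
  | _, _, _ => False

/-- A run, given by its first state and its sequence of transitions, is a run over `w`. It starts
in an initial state and ends in an accepting state. -/
def IsRun (M : OneWayAutomaton A B) (w : List A)
    (r : M.State × List (OutTransition M.State A B)) : Prop :=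
  r.1 ∈ M.initial ∧ M.IsAcceptingPath r.1 w r.2

/-- The output of a sequence of transitions. The letters output by the `i`-th transition, which
reads the `i`-th input letter, have the origin `i`. -/
def pathOutput {Q : Type} (ts : List (OutTransition Q A B)) : List (B × ℕ) :=
  ts.zipIdx.flatMap fun p => p.1.out.map fun b => (b, p.2)

end OneWayAutomaton

/-- `f` is recognised by a nondeterministic one-way automaton with output which has exactly one
run over every input string. -/
def OriginTransducer.IsUnambiguousOneWay {A : Type u} {B : Type v}
    (f : OriginTransducer A B) : Prop :=
  ∃ M : OneWayAutomaton A B,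
    (∀ w, ∃! r, M.IsRun w r) ∧
      ∀ w r, M.IsRun w r → OneWayAutomaton.pathOutput r.2 = f.value w

/-! ### Lists sorted by a key -/

/-! Conditions 1 and 2 agree because two output letters are in the wrong order exactly when some cut
of the input puts the earlier one on the right and the later one on the left
(`orderPreserving_iff_leftThenRight`). The rest is the cycle 1 → 3 → 4 → 1.

1 → 3 carries the weight. A list sorted by origin is determined by its sublists of constant origin,
so it suffices to produce, for each input position, the letters born there in output order. Since
registers are never copied, the part of the output already created when a suffix is entered is a
concatenation of distinct registers, and this duplicate-free list (a `Plan`) depends only on the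
control state and the suffix. There are finitely many plans, and they are computed from right to
left, so a lookahead automaton can supply them. At each letter, the plan says which new letters
survive and in which order (`atOrigin_outputFrom_of_lt`, `atOrigin_outputFrom_of_le`).

3 → 4: the automaton guesses the lookahead. Acceptance fixes the last guess and determinism from the
right fixes the others, so the run is unique. 4 → 1: a one-way automaton writes its letters in the
order of their origins. -/

theorem List.eq_of_pairwise_of_filter_eq {β : Type*} {l₁ l₂ : List (β × ℕ)}
    (h₁ : l₁.Pairwise fun x y => x.2 ≤ y.2) (h₂ : l₂.Pairwise fun x y => x.2 ≤ y.2)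
    (h : ∀ j, l₁.filter (fun x => x.2 = j) = l₂.filter (fun x => x.2 = j)) : l₁ = l₂ := by
  have key : ∀ x, x ∈ l₁ ↔ x ∈ l₂ := fun x => by
    have := congrArg (x ∈ ·) (h x.2)
    simpa using this
  induction l₁ generalizing l₂ with
  | nil =>
    cases l₂ with
    | nil => rfl
    | cons y l₂ => simpa using key y
  | cons x l₁ ih =>
    cases l₂ with
    | nil => simpa using key x
    | cons y l₂ =>
      rw [List.pairwise_cons] at h₁ h₂
      -- Each head has the least key of its list and also occurs in the other list, so the keys
      -- agree; both heads are then first in the sublist for that key.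
      have hxy : x.2 = y.2 := by
        apply le_antisymm
        · rcases List.mem_cons.1 ((key y).2 (by simp)) with e | e
          · rw [e]
          · exact h₁.1 _ e
        · rcases List.mem_cons.1 ((key x).1 (by simp)) with e | e
          · rw [e]
          · exact h₂.1 _ e
      have e : x = y := by
        have := h x.2
        simp only [List.filter_cons, hxy, decide_true, if_true] at this
        exact (List.cons.inj this).1
      subst e
      have h' : ∀ j, l₁.filter (fun x => x.2 = j) = l₂.filter (fun x => x.2 = j) := fun j => by
        have := h j
        simp only [List.filter_cons] at this
        split at this
        · exact (List.cons.inj this).2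
        · exact this
      refine congrArg _ (ih h₁.2 h₂.2 h' fun z => ?_)
      have := congrArg (z ∈ ·) (h' z.2)
      simpa using this

/-! ### Order-preserving origins and two-block factorisations -/

namespace FactoredOutput

variable {B : Type*}

theorem map_fst_cons {X : Type*} [DecidableEq X] (c : X) (b : B) (bs : FactoredOutput X B) :
    (cons c b bs).map Prod.fst =
      if (bs.map Prod.fst).head? = some c then bs.map Prod.fst else c :: bs.map Prod.fst := by
  rcases bs with _ | ⟨⟨c', s⟩, bs⟩
  · simp [cons]
  · by_cases h : c = c'
    · simp [cons, h]
    · simp [cons, h, Ne.symm h]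

theorem mem_map_fst_foldr_cons {X Y : Type*} [DecidableEq X] (σ : Y → X) (l : List (B × Y))
    (c : X) :
    c ∈ (l.foldr (fun p bs => cons (σ p.2) p.1 bs) []).map Prod.fst ↔ ∃ p ∈ l, σ p.2 = c := by
  induction l with
  | nil => simp
  | cons p l ih =>
    rw [List.foldr_cons, map_fst_cons]
    split
    · rename_i h
      have hp : σ p.2 = c → ∃ q ∈ l, σ q.2 = c := fun e => ih.1 (e ▸ List.mem_of_head? h)
      simp only [ih, List.mem_cons, exists_eq_or_imp]
      tauto
    · simp only [List.mem_cons, ih, exists_eq_or_imp]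
      tauto

end FactoredOutput

theorem Language.mem_one_add_mul_one_add {α : Type*} (a b : α) (l : List α) :
    l ∈ ((1 + {[a]}) * (1 + {[b]}) : Language α) ↔ l = [] ∨ l = [a] ∨ l = [b] ∨ l = [a, b] := by
  rw [Language.mem_mul]
  constructor
  · rintro ⟨x, hx, y, hy, rfl⟩
    change (x = [] ∨ x = [a]) at hx
    change (y = [] ∨ y = [b]) at hy
    rcases hx with rfl | rfl <;> rcases hy with rfl | rfl <;> simp
  · rintro (rfl | rfl | rfl | rfl)
    · exact ⟨[], .inl rfl, [], .inl rfl, rfl⟩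
    · exact ⟨[a], .inr rfl, [], .inl rfl, rfl⟩
    · exact ⟨[], .inl rfl, [b], .inr rfl, rfl⟩
    · exact ⟨[a], .inr rfl, [b], .inr rfl, rfl⟩

namespace OriginTransducer

variable {A : Type u} {B : Type v}

/-- Underlining both sides erases every output assignment, so only the sequence of block colours
matters. -/
theorem splitUnderlined_mem_iff (f : OriginTransducer A B) (v w : List A) :
    f.splitUnderlined v w ∈
      ((1 + {[bareBlock B Side.left]}) * (1 + {[bareBlock B Side.right]}) :
        Language (Side × Option (List B))) ↔
      (f.split v w).map Prod.fst ∈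
        ({[], [.left], [.right], [.left, .right]} : Set (List Side)) := by
  have h : f.splitUnderlined v w = ((f.split v w).map Prod.fst).map (bareBlock B) := by
    unfold splitUnderlined FactoredOutput.underline
    rw [List.map_map]
    refine List.map_congr_left fun p _ => ?_
    rcases p with ⟨_ | _, s⟩ <;> simp [bareBlock]
  have hinj : Function.Injective (List.map (bareBlock B)) :=
    List.map_injective_iff.2 fun s t e => (Prod.mk.inj e).1
  rw [Language.mem_one_add_mul_one_add, h]
  simp only [Set.mem_insert_iff, Set.mem_singleton_iff]
  rw [← hinj.eq_iff (b := []), ← hinj.eq_iff (b := [.left]), ← hinj.eq_iff (b := [.right]),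
    ← hinj.eq_iff (b := [.left, .right])]
  rfl

/-- The four allowed colour words are those in which nothing but `right` follows a `right`. -/
theorem map_fst_foldr_cons_mem_iff {Y : Type*} (σ : Y → Side) (l : List (B × Y)) :
    (l.foldr (fun p bs => FactoredOutput.cons (σ p.2) p.1 bs) []).map Prod.fst ∈
        ({[], [.left], [.right], [.left, .right]} : Set (List Side)) ↔
      l.Pairwise fun p q => σ p.2 = .right → σ q.2 = .right := by
  induction l with
  | nil => simp
  | cons p l ih =>
    rw [List.foldr_cons, FactoredOutput.map_fst_cons, List.pairwise_cons, ← ih]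
    have hm := FactoredOutput.mem_map_fst_foldr_cons σ l .left
    have hr : (∀ q ∈ l, σ p.2 = .right → σ q.2 = .right) ↔
        (σ p.2 = .right → ¬ ∃ q ∈ l, σ q.2 = .left) := by
      have : ∀ s : Side, s = .right ↔ ¬ s = .left := by rintro (_ | _) <;> simp
      simp only [this]
      push Not
      tauto
    rw [hr, ← hm]
    -- What remains holds for an arbitrary word `g`, alternating or not, and is decided by its first
    -- two symbols and whether there are more.
    generalize (l.foldr (fun p bs => FactoredOutput.cons (σ p.2) p.1 bs) []).map Prod.fst = g
    rcases σ p.2 with _ | _ <;> rcases g with _ | ⟨_ | _, _ | ⟨_ | _, g⟩⟩ <;> simp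

theorem orderPreserving_iff_pairwise (f : OriginTransducer A B) :
    f.OrderPreserving ↔ ∀ w, (f w).Pairwise fun x y => x.2 ≤ y.2 := by
  refine forall_congr' fun w => ?_
  rw [List.pairwise_iff_get]
  exact monotone_iff_forall_lt

theorem pairwise_value_iff (f : OriginTransducer A B) (w : List A) :
    ((f.value w).Pairwise fun x y => x.2 ≤ y.2) ↔ (f w).Pairwise fun x y => x.2 ≤ y.2 := by
  simp [value, List.pairwise_map]

theorem orderPreserving_iff_leftThenRight (f : OriginTransducer A B) :
    f.OrderPreserving ↔ f.LeftThenRight := by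
  rw [orderPreserving_iff_pairwise]
  unfold LeftThenRight
  simp only [splitUnderlined_mem_iff]
  unfold split factored
  have key : ∀ v w : List A, _ ↔ _ := fun v w => map_fst_foldr_cons_mem_iff
    (fun i : Fin (v ++ w).length => if (i : ℕ) < v.length then Side.left else Side.right)
    (f (v ++ w))
  simp only [key]
  constructor
  · intro h v w
    refine (h (v ++ w)).imp fun {p q} hpq => ?_
    rw [Fin.le_def] at hpq
    split_ifs <;> simp
    omega
  · intro h w
    rw [List.pairwise_iff_get]
    intro i j hij
    by_contra hlt
    rw [not_le, Fin.lt_def] at hlt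
    -- Cutting just before the origin of the earlier letter colours that letter `right` and the
    -- offending later one `left`.
    set k : ℕ := (((f w).get i).2 : Fin w.length).val with hk
    have hkw : k < w.length := ((f w).get i).2.isLt
    have hw : ∃ v u, w = v ++ u ∧ v.length = k :=
      ⟨w.take k, w.drop k, by simp, by simp; omega⟩
    obtain ⟨v, u, rfl, hv⟩ := hw
    have := List.pairwise_iff_get.1 (h v u) i j hij
    rw [← hk, hv] at this
    simp only [List.get_eq_getElem] at this hlt
    simp [hlt] at this

end OriginTransducer

/-! ### Outputs of one-way automata -/

namespace OneWayAutomaton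

variable {A : Type u} {B : Type v}

/-- The output of a sequence of transitions whose first transition reads position `k`. -/
def pathOutputFrom {Q : Type} (k : ℕ) (ts : List (OutTransition Q A B)) : List (B × ℕ) :=
  (ts.zipIdx k).flatMap fun p => p.1.out.map fun b => (b, p.2)

theorem pathOutputFrom_cons {Q : Type} (k : ℕ) (t : OutTransition Q A B)
    (ts : List (OutTransition Q A B)) :
    pathOutputFrom k (t :: ts) = (t.out.map fun b => (b, k)) ++ pathOutputFrom (k + 1) ts := by
  simp [pathOutputFrom, List.zipIdx_cons]

theorem le_of_mem_pathOutputFrom {Q : Type} {k : ℕ} {ts : List (OutTransition Q A B)}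
    {x : B × ℕ} (h : x ∈ pathOutputFrom k ts) : k ≤ x.2 := by
  simp only [pathOutputFrom, List.mem_flatMap, List.mem_map] at h
  obtain ⟨p, hp, b, -, rfl⟩ := h
  exact List.le_snd_of_mem_zipIdx (x := p) hp

theorem pairwise_pathOutputFrom {Q : Type} (k : ℕ) (ts : List (OutTransition Q A B)) :
    (pathOutputFrom k ts).Pairwise fun x y => x.2 ≤ y.2 := by
  induction ts generalizing k with
  | nil => simp [pathOutputFrom]
  | cons t ts ih =>
    rw [pathOutputFrom_cons, List.pairwise_append]
    refine ⟨by simp [List.pairwise_iff_getElem], ih _, ?_⟩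
    intro x hx y hy
    obtain ⟨b, -, rfl⟩ := List.mem_map.1 hx
    have := le_of_mem_pathOutputFrom hy
    simp only
    omega

end OneWayAutomaton

theorem OriginTransducer.IsUnambiguousOneWay.orderPreserving {A : Type u} {B : Type v}
    {f : OriginTransducer A B} (h : f.IsUnambiguousOneWay) : f.OrderPreserving := by
  obtain ⟨M, hM, hout⟩ := h
  rw [orderPreserving_iff_pairwise]
  intro w
  obtain ⟨r, hr, -⟩ := hM w
  rw [← pairwise_value_iff, ← hout w r hr]
  exact OneWayAutomaton.pairwise_pathOutputFrom 0 r.2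

/-! ### Append-only transducers -/

/-- The letters written by a sequence of operations which append to the only register. -/
def RegOp.letters {R : Type} {B : Type v} (os : List (RegOp R B)) : List B :=
  os.filterMap fun
    | .append _ b => some b
    | _ => none

theorem RegOp.foldl_apply_of_isAppend {R : Type} {B : Type v} [Subsingleton R]
    (os : List (RegOp R B)) (hos : ∀ o ∈ os, o.IsAppend) (i : ℕ) (ν : R → List (B × ℕ)) (r : R) :
    os.foldl (RegOp.apply i) ν r = ν r ++ (RegOp.letters os).map fun b => (b, i) := by
  induction os generalizing ν with
  | nil => simp [RegOp.letters]
  | cons o os ih =>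
    rw [List.foldl_cons, ih fun o ho => hos o (by simp [ho])]
    have ho := hos o (by simp)
    rcases o with _ | _ | ⟨s, b⟩
    · exact ho.elim
    · exact ho.elim
    · obtain rfl := Subsingleton.elim r s
      simp [RegOp.apply, RegOp.letters]

namespace StreamingTransducer

variable {A : Type u} {B : Type v}

/-- The output produced by reading a suffix of the input, which starts at position `k`, from a
given configuration. -/
noncomputable def outputFrom (T : StreamingTransducer A B) (c : T.Config) (k : ℕ) (w : List A) :
    List (B × ℕ) :=
  let c' := (w.zipIdx k).foldl T.next c
  (T.final c'.1).foldl (fun ν c => c.apply ν) c'.2 T.outReg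

theorem outputFrom_cons (T : StreamingTransducer A B) (c : T.Config) (k : ℕ) (a : A)
    (w : List A) : T.outputFrom c k (a :: w) = T.outputFrom (T.next c (a, k)) (k + 1) w := by
  simp [outputFrom, List.zipIdx_cons]

/-- The letters written by an append-only transducer while reading a suffix of the input. -/
def written (T : StreamingTransducer A B) : T.State → ℕ → List A → List (B × ℕ)
  | _, _, [] => []
  | q, k, a :: w =>
      ((RegOp.letters (T.step q a).2).map fun b => (b, k)) ++ T.written (T.step q a).1 (k + 1) w

/-- Appending never alters what is already there, so what is added depends on the control state
alone. -/
theorem IsOneRegisterAppendOnly.outputFrom_eq {T : StreamingTransducer A B}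
    (hT : T.IsOneRegisterAppendOnly) (c : T.Config) (k : ℕ) (w : List A) :
    T.outputFrom c k w = c.2 T.outReg ++ T.written c.1 k w := by
  induction w generalizing c k with
  | nil => simp [outputFrom, written, hT.2.2]
  | cons a w ih =>
    have : Subsingleton T.Reg := (Nat.card_eq_one_iff_unique.1 hT.1).1
    rw [outputFrom_cons, ih]
    simp [next, written, RegOp.foldl_apply_of_isAppend _ (hT.2.1 c.1 a)]

theorem le_of_mem_written {T : StreamingTransducer A B} {q : T.State} {k : ℕ} {w : List A}
    {x : B × ℕ} (h : x ∈ T.written q k w) : k ≤ x.2 := by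
  induction w generalizing q k with
  | nil => simp [written] at h
  | cons a w ih =>
    rcases List.mem_append.1 h with h | h
    · obtain ⟨b, -, rfl⟩ := List.mem_map.1 h
      exact le_rfl
    · have := ih h
      omega

theorem pairwise_written (T : StreamingTransducer A B) (q : T.State) (k : ℕ) (w : List A) :
    (T.written q k w).Pairwise fun x y => x.2 ≤ y.2 := by
  induction w generalizing q k with
  | nil => simp [written]
  | cons a w ih =>
    rw [written, List.pairwise_append]
    refine ⟨by simp [List.pairwise_iff_getElem], ih _ _, ?_⟩
    intro x hx y hy
    obtain ⟨b, -, rfl⟩ := List.mem_map.1 hx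
    have := le_of_mem_written hy
    simp only
    omega

end StreamingTransducer

/-! ### From lookahead to unambiguous nondeterminism -/

namespace LookaheadTransducer

variable {A : Type u} {B : Type v}

/-- The transition reading `a` in state `q`, if the lookahead after this letter is `l`. -/
def guess (T : LookaheadTransducer A B) (q : T.core.State) (l : T.Look) (a : A) :
    OutTransition (T.core.State × T.Look) A B where
  src := (q, T.lookStep l a)
  letter := a
  out := RegOp.letters (T.core.step q (a, l)).2
  tgt := ((T.core.step q (a, l)).1, l)

/-- The one-way automaton which guesses the lookahead and verifies it. -/
def toOneWay [Finite A] (T : LookaheadTransducer A B) : OneWayAutomaton A B where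
  State := T.core.State × T.Look
  finite_state :=
    have := T.core.finite_state
    have := T.finite_look
    inferInstance
  initial := {p | p.1 = T.core.start}
  -- The second component claims the lookahead of the unread suffix: it is free at the start, and at
  -- the end it must be that of the empty suffix.
  accepting := {p | p.2 = T.lookStart}
  trans := Set.range fun x : T.core.State × T.Look × A => T.guess x.1 x.2.1 x.2.2
  finite_trans :=
    have := T.core.finite_state
    have := T.finite_look
    Set.finite_range _

/-- The path with the correct guesses. -/
def path (T : LookaheadTransducer A B) :
    T.core.State → List A → List (OutTransition (T.core.State × T.Look) A B)
  | _, [] => []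
  | q, a :: w =>
      T.guess q (T.lookState w) a :: T.path (T.core.step q (a, T.lookState w)).1 w

/-- The guesses are forced from the right: the rest of the path fixes the lookahead after a letter,
and `lookStep` then fixes the one before it. -/
theorem isAcceptingPath_toOneWay_iff [Finite A] (T : LookaheadTransducer A B)
    (q : T.core.State) (l : T.Look) (w : List A)
    (ts : List (OutTransition (T.core.State × T.Look) A B)) :
    T.toOneWay.IsAcceptingPath (q, l) w ts ↔ l = T.lookState w ∧ ts = T.path q w := by
  induction w generalizing q l ts with
  | nil =>
    cases ts with
    | nil => exact (and_iff_left rfl).symm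
    | cons t ts => simp [OneWayAutomaton.IsAcceptingPath, path]
  | cons a w ih =>
    cases ts with
    | nil => simp [OneWayAutomaton.IsAcceptingPath, path]
    | cons t ts =>
      simp only [OneWayAutomaton.IsAcceptingPath, path, List.cons.injEq]
      constructor
      · rintro ⟨⟨⟨q', l', a'⟩, rfl⟩, hs, rfl, hp⟩
        obtain ⟨rfl, rfl⟩ := Prod.mk.inj hs
        obtain ⟨rfl, rfl⟩ := (ih _ _ _).1 hp
        exact ⟨rfl, rfl, rfl⟩
      · rintro ⟨rfl, rfl, rfl⟩
        exact ⟨⟨(q, T.lookState w, a), rfl⟩, rfl, rfl, (ih _ _ _).2 ⟨rfl, rfl⟩⟩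

theorem pathOutputFrom_path (T : LookaheadTransducer A B) (q : T.core.State) (k : ℕ)
    (w : List A) :
    OneWayAutomaton.pathOutputFrom k (T.path q w) = T.core.written q k (T.annotate w) := by
  induction w generalizing q k with
  | nil => rfl
  | cons a w ih =>
    rw [path, OneWayAutomaton.pathOutputFrom_cons, ih]
    rfl

theorem output_eq_written {T : LookaheadTransducer A B} (hT : T.core.IsOneRegisterAppendOnly)
    (w : List A) : T.output w = T.core.written T.core.start 0 (T.annotate w) :=
  hT.outputFrom_eq (T.core.start, fun _ => []) 0 _

end LookaheadTransducer

theorem OriginTransducer.IsOneRegisterLookahead.isUnambiguousOneWay {A : Type u} {B : Type v}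
    [Finite A] {f : OriginTransducer A B} (h : f.IsOneRegisterLookahead) :
    f.IsUnambiguousOneWay := by
  obtain ⟨T, hT, hout⟩ := h
  have key : ∀ w r, T.toOneWay.IsRun w r ↔
      r = ((T.core.start, T.lookState w), T.path T.core.start w) := by
    rintro w ⟨⟨q, l⟩, ts⟩
    refine (and_congr_right fun _ => T.isAcceptingPath_toOneWay_iff q l w ts).trans ?_
    change (q = T.core.start ∧ _) ↔ _
    constructor
    · rintro ⟨rfl, rfl, rfl⟩
      rfl
    · intro e
      cases e
      exact ⟨rfl, rfl, rfl⟩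
  refine ⟨T.toOneWay, fun w => ⟨_, (key w _).2 rfl, fun r hr => (key w r).1 hr⟩, ?_⟩
  intro w r hr
  rw [(key w r).1 hr, ← hout w, LookaheadTransducer.output_eq_written hT]
  exact T.pathOutputFrom_path _ 0 w

/-! ### Symbolic register contents -/

open Classical in
/-- The effect of a concatenation on an arbitrary valuation by lists. -/
noncomputable def RegConcat.act {R : Type} {α : Type*} (c : RegConcat R) (μ : R → List α) :
    R → List α :=
  Function.update (Function.update μ c.dst (μ c.dst ++ μ c.src)) c.src []

open Classical in
/-- The effect of an operation on symbolic register contents, ignoring new letters. -/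
noncomputable def RegOp.old {R : Type} {B : Type v} (μ : R → List R) :
    RegOp R B → (R → List R)
  | .concat c => c.act μ
  | .load r _ => Function.update μ r []
  | .append _ _ => μ

open Classical in
/-- The effect of an operation on the newly created letters. -/
noncomputable def RegOp.fresh {R : Type} {B : Type v} (ρ : R → List B) :
    RegOp R B → (R → List B)
  | .concat c => c.act ρ
  | .load r b => Function.update ρ r [b]
  | .append r b => Function.update ρ r (ρ r ++ [b])

/-- A valuation by lists in which nothing occurs twice. -/
def IsCopyless {R : Type} {α : Type*} (μ : R → List α) : Prop :=
  (∀ r, (μ r).Nodup) ∧ ∀ r s, r ≠ s → (μ r).Disjoint (μ s)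

theorem isCopyless_singleton {R : Type} : IsCopyless fun r : R => [r] :=
  ⟨fun r => List.nodup_singleton r, fun r s h => by simpa using h.symm⟩

/-- The content of `src` is moved, not copied: `src` is emptied, and its old content was disjoint
from that of `dst`. -/
theorem IsCopyless.act {R : Type} {α : Type*} {μ : R → List α} (h : IsCopyless μ)
    (c : RegConcat R) : IsCopyless (c.act μ) := by
  classical
  have hval : ∀ r, c.act μ r =
      if r = c.src then [] else if r = c.dst then μ c.dst ++ μ c.src else μ r := fun r => by
    simp only [RegConcat.act, Function.update_apply]
  have hd := h.2 _ _ c.ne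
  constructor
  · intro r
    rw [hval]
    split_ifs
    · exact List.nodup_nil
    · exact List.Nodup.append (h.1 _) (h.1 _) hd
    · exact h.1 _
  · intro r s hrs
    rw [hval, hval]
    split_ifs with h1 h2 h3 h4 h5 h6
    · exact List.disjoint_nil_left _
    · exact List.disjoint_nil_left _
    · exact List.disjoint_nil_left _
    · exact List.disjoint_nil_right _
    · exact absurd (h4.trans h6.symm) hrs
    · exact List.disjoint_append_left.2 ⟨h.2 _ _ (Ne.symm ‹_›), h.2 _ _ (Ne.symm ‹_›)⟩
    · exact List.disjoint_nil_right _
    · exact List.disjoint_append_right.2 ⟨h.2 _ _ ‹_›, h.2 _ _ ‹_›⟩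
    · exact h.2 _ _ hrs

theorem IsCopyless.old {R : Type} {B : Type v} {μ : R → List R} (h : IsCopyless μ)
    (o : RegOp R B) : IsCopyless (RegOp.old μ o) := by
  classical
  rcases o with c | ⟨r, b⟩ | ⟨r, b⟩
  · exact h.act c
  · constructor
    · intro s
      simp only [RegOp.old, Function.update_apply]
      split_ifs
      · exact List.nodup_nil
      · exact h.1 s
    · intro s t hst
      simp only [RegOp.old, Function.update_apply]
      split_ifs
      · simp
      · simp
      · simp
      · exact h.2 s t hst
  · exact h

theorem IsCopyless.foldl_old {R : Type} {B : Type v} (os : List (RegOp R B)) {μ : R → List R}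
    (h : IsCopyless μ) : IsCopyless (os.foldl RegOp.old μ) := by
  induction os generalizing μ with
  | nil => exact h
  | cons o os ih => exact ih (h.old o)

theorem IsCopyless.foldl_act {R : Type} {α : Type*} (cs : List (RegConcat R)) {μ : R → List α}
    (h : IsCopyless μ) : IsCopyless (cs.foldl (fun μ c => c.act μ) μ) := by
  induction cs generalizing μ with
  | nil => exact h
  | cons c cs ih => exact ih (h.act c)

/-- This keeps plans duplicate-free when they are pulled back over a letter, and hence keeps their
number finite. -/
theorem IsCopyless.nodup_flatMap {R : Type} {α : Type*} {μ : R → List α} (h : IsCopyless μ)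
    {l : List R} (hl : l.Nodup) : (l.flatMap μ).Nodup :=
  List.nodup_flatMap.2 ⟨fun r _ => h.1 r, hl.imp fun {r s} => h.2 r s⟩

/-- The letters of origin `j` in a register content. -/
def atOrigin {B : Type v} (j : ℕ) (l : List (B × ℕ)) : List (B × ℕ) :=
  l.filter fun x => x.2 = j

theorem atOrigin_append {B : Type v} (j : ℕ) (l l' : List (B × ℕ)) :
    atOrigin j (l ++ l') = atOrigin j l ++ atOrigin j l' :=
  List.filter_append ..

theorem atOrigin_eq_nil {B : Type v} {j : ℕ} {l : List (B × ℕ)} :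
    atOrigin j l = [] ↔ ∀ x ∈ l, x.2 ≠ j := by
  simp [atOrigin]

/-- Interpreting the symbols commutes with concatenation. -/
theorem RegConcat.atOrigin_apply {R : Type} {B : Type v} {α : Type*} (c : RegConcat R) (j : ℕ)
    {ν : R → List (B × ℕ)} {μ : R → List α} {g : α → List (B × ℕ)}
    (h : ∀ r, atOrigin j (ν r) = (μ r).flatMap g) (r : R) :
    atOrigin j (c.apply ν r) = (c.act μ r).flatMap g := by
  classical
  simp only [RegConcat.apply, RegConcat.act, Function.update_apply]
  split_ifs
  · rfl
  · rw [atOrigin_append, h, h, List.flatMap_append]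
  · exact h r

theorem RegConcat.atOrigin_foldl_apply {R : Type} {B : Type v} {α : Type*}
    (cs : List (RegConcat R)) (j : ℕ) {ν : R → List (B × ℕ)} {μ : R → List α}
    {g : α → List (B × ℕ)} (h : ∀ r, atOrigin j (ν r) = (μ r).flatMap g) (r : R) :
    atOrigin j (cs.foldl (fun ν c => c.apply ν) ν r) =
      (cs.foldl (fun μ c => c.act μ) μ r).flatMap g := by
  induction cs generalizing ν μ with
  | nil => exact h r
  | cons c cs ih => exact ih (c.atOrigin_apply j h)

/-- Operations at position `i` create no letter of origin `j`; they only move or discard existing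
content, which `RegOp.old` tracks. -/
theorem RegOp.atOrigin_foldl_apply_of_ne {R : Type} {B : Type v} (os : List (RegOp R B))
    {i j : ℕ} (hij : i ≠ j) {ν : R → List (B × ℕ)} {μ : R → List R} {g : R → List (B × ℕ)}
    (h : ∀ r, atOrigin j (ν r) = (μ r).flatMap g) (r : R) :
    atOrigin j (os.foldl (RegOp.apply i) ν r) = (os.foldl RegOp.old μ r).flatMap g := by
  classical
  induction os generalizing ν μ with
  | nil => exact h r
  | cons o os ih =>
    refine ih fun s => ?_
    rcases o with c | ⟨t, b⟩ | ⟨t, b⟩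
    · exact c.atOrigin_apply j h s
    · simp only [RegOp.apply, RegOp.old, Function.update_apply]
      split_ifs
      · simp [atOrigin, hij]
      · exact h s
    · simp only [RegOp.apply, RegOp.old, Function.update_apply]
      split_ifs with e
      · rw [atOrigin_append, h, e]
        simp [atOrigin, hij]
      · exact h s

theorem RegOp.atOrigin_foldl_apply_self {R : Type} {B : Type v} (os : List (RegOp R B))
    {i : ℕ} {ν : R → List (B × ℕ)} {ρ : R → List B}
    (h : ∀ r, atOrigin i (ν r) = (ρ r).flatMap fun b => [(b, i)]) (r : R) :
    atOrigin i (os.foldl (RegOp.apply i) ν r) =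
      (os.foldl RegOp.fresh ρ r).flatMap fun b => [(b, i)] := by
  classical
  induction os generalizing ν ρ with
  | nil => exact h r
  | cons o os ih =>
    refine ih fun s => ?_
    rcases o with c | ⟨t, b⟩ | ⟨t, b⟩
    · exact c.atOrigin_apply i h s
    · simp only [RegOp.apply, RegOp.fresh, Function.update_apply]
      split_ifs
      · simp [atOrigin]
      · exact h s
    · simp only [RegOp.apply, RegOp.fresh, Function.update_apply]
      split_ifs
      · rw [atOrigin_append, h, List.flatMap_append]
        simp [atOrigin]
      · exact h s

/-! ### The lookahead transducer of a streaming transducer -/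

namespace StreamingTransducer

variable {A : Type u} {B : Type v}

/-- The registers whose contents, in this order, make up the old part of the output, for every
state in which the remaining input may be entered. -/
abbrev Plan (T : StreamingTransducer A B) : Type :=
  T.State → {l : List T.Reg // l.Nodup}

/-- The plan at the end of the input. -/
noncomputable def finalPlan (T : StreamingTransducer A B) : T.Plan := fun q =>
  ⟨(T.final q).foldl (fun μ c => c.act μ) (fun r => [r]) T.outReg,
    (isCopyless_singleton.foldl_act _).1 _⟩

/-- The plan before a letter, given the plan after it. -/
noncomputable def prevPlan (T : StreamingTransducer A B) (P : T.Plan) (a : A) : T.Plan :=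
  fun q =>
    ⟨(P (T.step q a).1).1.flatMap ((T.step q a).2.foldl RegOp.old fun r => [r]),
      (isCopyless_singleton.foldl_old _).nodup_flatMap (P (T.step q a).1).2⟩

/-- The letters which are created when `a` is read in state `q` and which occur in the output,
if the rest of the input has the plan `P`. -/
noncomputable def emitted (T : StreamingTransducer A B) (q : T.State) (a : A) (P : T.Plan) :
    List B :=
  (P (T.step q a).1).1.flatMap ((T.step q a).2.foldl RegOp.fresh fun _ => [])

/-- The lookahead computes the plan; the letters are written in the order of their origins. -/
noncomputable def toLookahead (T : StreamingTransducer A B) : LookaheadTransducer A B where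
  Look := T.Plan
  -- Finitely many states, and finitely many duplicate-free lists over a finite set of registers.
  finite_look := by
    classical
    have := T.finite_state
    have := T.finite_reg
    have := Fintype.ofFinite T.Reg
    infer_instance
  lookStart := T.finalPlan
  lookStep := T.prevPlan
  core :=
    { State := T.State
      finite_state := T.finite_state
      Reg := Unit
      finite_reg := inferInstance
      start := T.start
      outReg := ()
      step := fun q p => ((T.step q p.1).1, (T.emitted q p.1 p.2).map (RegOp.append ()))
      final := fun _ => [] }

theorem isOneRegisterAppendOnly_toLookahead (T : StreamingTransducer A B) :
    T.toLookahead.core.IsOneRegisterAppendOnly := by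
  refine ⟨(Nat.card_unique : Nat.card Unit = 1), fun q a o ho => ?_, fun _ => rfl⟩
  obtain ⟨b, -, rfl⟩ := List.mem_map.1 ho
  trivial

/-- Letters of origin below `k` already sit in registers, and the remaining input can only arrange
or drop whole registers, as the plan prescribes. -/
theorem atOrigin_outputFrom_of_lt (T : StreamingTransducer A B) (c : T.Config) {j k : ℕ}
    (hj : j < k) (w : List A) :
    atOrigin j (T.outputFrom c k w) =
      (T.toLookahead.lookState w c.1).1.flatMap fun r => atOrigin j (c.2 r) := by
  induction w generalizing c k with
  | nil => exact RegConcat.atOrigin_foldl_apply _ j (fun r => by simp) _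
  | cons a w ih =>
    rw [outputFrom_cons, ih _ (by omega)]
    change _ = (List.flatMap _ _).flatMap _
    rw [List.flatMap_assoc]
    congr 1
    funext r
    exact RegOp.atOrigin_foldl_apply_of_ne _ (by omega) (fun r => by simp) r

theorem letters_map_append {R : Type} (r : R) (l : List B) :
    RegOp.letters (l.map (RegOp.append r)) = l := by
  induction l with
  | nil => rfl
  | cons b l ih =>
    exact congrArg (List.cons b) ih

theorem atOrigin_foldl_apply_eq_nil {R : Type} (os : List (RegOp R B)) {k : ℕ}
    {ν : R → List (B × ℕ)} (hν : ∀ j, k < j → ∀ r, atOrigin j (ν r) = []) :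
    ∀ j, k < j → ∀ r, atOrigin j (os.foldl (RegOp.apply k) ν r) = [] := by
  intro j hj r
  -- Interpreting every register symbol as the empty list encodes the absence of origin `j`.
  rw [RegOp.atOrigin_foldl_apply_of_ne os hj.ne (μ := fun r => [r]) (g := fun _ => [])
    fun r => by simp [hν j hj r]]
  simp

/-- Origin by origin, the lookahead transducer agrees with any streaming transducer; only the
interleaving of different origins may differ. -/
theorem atOrigin_outputFrom_of_le (T : StreamingTransducer A B) (c : T.Config) {j k : ℕ}
    (hj : k ≤ j) (hc : ∀ j, k ≤ j → ∀ r, atOrigin j (c.2 r) = []) (w : List A) :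
    atOrigin j (T.outputFrom c k w) =
      atOrigin j (T.toLookahead.core.written c.1 k (T.toLookahead.annotate w)) := by
  induction w generalizing c k with
  | nil =>
    refine (RegConcat.atOrigin_foldl_apply _ j (μ := fun r => [r]) (g := fun _ => [])
      (fun r => by simp [hc j hj r]) _).trans ?_
    simp [LookaheadTransducer.annotate, written, atOrigin]
  | cons a w ih =>
    have hwritten : T.toLookahead.core.written c.1 k (T.toLookahead.annotate (a :: w)) =
        ((T.emitted c.1 a (T.toLookahead.lookState w)).map fun b => (b, k)) ++
          T.toLookahead.core.written (T.step c.1 a).1 (k + 1) (T.toLookahead.annotate w) :=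
      congrArg (fun l : List B => (l.map fun b => (b, k)) ++
        T.toLookahead.core.written (T.step c.1 a).1 (k + 1) (T.toLookahead.annotate w))
        (letters_map_append () (T.emitted c.1 a (T.toLookahead.lookState w)))
    rw [outputFrom_cons, hwritten, atOrigin_append]
    rcases hj.eq_or_lt with rfl | hj
    -- Once the letter at `k` is read, origin `k` lies in the past of position `k + 1`, so the plan
    -- for the suffix governs it.
    · rw [atOrigin_outputFrom_of_lt _ _ (by omega)]
      have h1 : atOrigin k (T.toLookahead.core.written (T.step c.1 a).1 (k + 1)
          (T.toLookahead.annotate w)) = [] :=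
        atOrigin_eq_nil.2 fun x hx => by
          have := le_of_mem_written hx
          omega
      rw [h1, List.append_nil]
      have h2 : ∀ l : List B, atOrigin k (l.map fun b => (b, k)) = l.flatMap fun b => [(b, k)] :=
        fun l => by
          rw [← List.map_eq_flatMap]
          simp [atOrigin]
      rw [h2]
      refine (congrArg (List.flatMap · _) (funext fun r => ?_)).trans List.flatMap_assoc.symm
      exact RegOp.atOrigin_foldl_apply_self _ (fun r => by simp [hc k le_rfl r]) r
    · have h1 : ∀ l : List B, atOrigin j (l.map fun b => (b, k)) = [] := fun l =>
        atOrigin_eq_nil.2 fun x hx => by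
          obtain ⟨b, -, rfl⟩ := List.mem_map.1 hx
          exact hj.ne
      rw [h1, List.nil_append]
      exact ih (T.next c (a, k)) hj
        (atOrigin_foldl_apply_eq_nil _ fun j hj r => hc j hj.le r)

end StreamingTransducer

theorem OriginTransducer.OrderPreserving.isOneRegisterLookahead {A : Type u} {B : Type v}
    {f : OriginTransducer A B} (h : f.OrderPreserving) (hf : f.IsRegular) :
    f.IsOneRegisterLookahead := by
  obtain ⟨T, -, hT⟩ := hf
  refine ⟨T.toLookahead, T.isOneRegisterAppendOnly_toLookahead, fun w => ?_⟩
  rw [LookaheadTransducer.output_eq_written T.isOneRegisterAppendOnly_toLookahead, ← hT]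
  -- Order preservation enters here: it makes the original output sorted, so agreement at each
  -- origin becomes equality.
  refine List.eq_of_pairwise_of_filter_eq (StreamingTransducer.pairwise_written ..) ?_ fun j => ?_
  · rw [hT]
    exact (f.pairwise_value_iff w).2 (f.orderPreserving_iff_pairwise.1 h w)
  · exact (T.atOrigin_outputFrom_of_le (T.start, fun _ => []) j.zero_le
      (fun _ _ _ => rfl) w).symm

theorem theorem3 {A : Type u} {B : Type v} [Finite A] [Finite B] (f : OriginTransducer A B)
    (hf : f.IsRegular) :
    List.TFAE
      [ f.OrderPreserving,
        f.LeftThenRight,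
        f.IsOneRegisterLookahead,
        f.IsUnambiguousOneWay ] := by
  tfae_have 1 ↔ 2 := f.orderPreserving_iff_leftThenRight
  tfae_have 1 → 3 := fun h => h.isOneRegisterLookahead hf
  tfae_have 3 → 4 := fun h => h.isUnambiguousOneWay
  tfae_have 4 → 1 := fun h => h.orderPreserving
  tfae_finish
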